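/- Let $\Omega\subset\mathbb R^2$ be a convex polygonal domain and let $\Omega_h$ be a finite partition of $\Omega$ into open, non-degenerate convex quadrilaterals $K$: the elements are pairwise disjoint subsets of $\Omega$ and $\overline\Omega=\bigcup_{K}\overline K$. Let $\kappa>0$ (shear correction factor), $t>0$ (thickness) and $-1<\nu<1$ (Poisson ratio), and set \[ \mathcal C^{-1}\boldsymbol\tau=6\Big(\boldsymbol\tau-\tfrac{\nu}{1+\nu}\operatorname{tr}(\boldsymbol\tau)\,\boldsymbol I\Big),\qquad \boldsymbol J=\begin{bmatrix}0&1\\-1&0\end{bmatrix}. \] Bold letters denote vector- and tensor-valued functions and spaces. $\nabla$ of a vector field and $\nabla\cdot$ of a tensor field are taken row-wise, and $\boldsymbol H(\mathbf{div},K)$ is the space of tensor fields with rows in $H(\mathrm{div},K)$. Let \[ H^1(\Omega_h)=\{v\in L_2(\Omega): v|_K\in H^1(K)\ \forall K\in\Omega_h\},\qquad H(\mathrm{div},\Omega_h)=\{\boldsymbol q\in \boldsymbol L_2(\Omega):\boldsymbol q|_K\in H(\mathrm{div},K)\ \forall K\in\Omega_h\}, \] and similarly for the bold spaces; derivatives of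 functions in these spaces are taken element by element. Let $H^{1/2}_0(\partial\Omega_h)$ be the space of traces $v|_{\partial\Omega_h}=(v|_{\partial K})_{K\in\Omega_h}$ of functions $v\in H^1_0(\Omega)$, and $H^{-1/2}(\partial\Omega_h)$ the space of normal traces $\boldsymbol\eta\cdot\boldsymbol n|_{\partial\Omega_h}=(\boldsymbol\eta\cdot\boldsymbol n|_{\partial K})_{K\in\Omega_h}$ of fields $\boldsymbol\eta\in H(\mathrm{div},\Omega)$, where $\boldsymbol n$ is the outward unit normal of each $K$ and $\boldsymbol\eta\cdot\boldsymbol n|_{\partial K}$ is the functional on traces of functions in $H^1(K)$ given by \[ \langle z,\boldsymbol\eta\cdot\boldsymbol n\rangle_{1/2,\partial K}=(\nabla z,\boldsymbol\eta)_K+(z,\nabla\cdot\boldsymbol\eta)_K . \] The bold trace spaces have two components, each in the corresponding scalar space. Thus a trace is zero iff any $v\in H^1_0(\Omega)$ inducing it has $v|_K\in H^1_0(K)$ for every $K$, and a normal trace is zero iff it is the zero functional on $H^1(K)$ for every $K$. Write $(\cdot,\cdot)_{\Omega_h}=\sum_K(\cdot,\cdot)_K$ for sums of $L_2(K)$ inner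 products and $\langle\cdot,\cdot\rangle_{\partial\Omega_h}=\sum_K\langle\cdot,\cdot\rangle_{1/2,\partial K}$. The trial space $\mathcal U$ consists of all $\boldsymbol u=(\boldsymbol V,\boldsymbol M,w,\boldsymbol\psi,r,\hat w,\hat{\boldsymbol\psi},\hat V_n,\hat{\boldsymbol M}_n)$ in \[ \boldsymbol L_2(\Omega)\times\boldsymbol L_2(\Omega)\times L_2(\Omega)\times\boldsymbol L_2(\Omega)\times L_2(\Omega)\times H^{1/2}_0(\partial\Omega_h)\times\boldsymbol H^{1/2}_0(\partial\Omega_h)\times H^{-1/2}(\partial\Omega_h)\times\boldsymbol H^{-1/2}(\partial\Omega_h), \] where $\boldsymbol V,\boldsymbol\psi$ are vector fields and $\boldsymbol M$ is a $2\times2$ tensor field (not assumed symmetric). The test space $\mathcal V$ consists of all $\boldsymbol v=(\boldsymbol q,\boldsymbol\tau,z,\boldsymbol\varphi,s)$ in \[ H(\mathrm{div},\Omega_h)\times\boldsymbol H(\mathbf{div},\Omega_h)\times H^1(\Omega_h)\times\boldsymbol H^1(\Omega_h)\times L_2(\Omega), \] where $\boldsymbol\tau$ is a $2\times2$ tensor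 field and $\boldsymbol q,\boldsymbol\varphi$ are vector fields. Define \[ \begin{aligned} \mathcal B(\boldsymbol u,\boldsymbol v)={}&(\boldsymbol V,\kappa^{-1}t^2\boldsymbol q+\nabla z-\boldsymbol\varphi)_{\Omega_h}+(\boldsymbol M,\mathcal C^{-1}\boldsymbol\tau+\nabla\boldsymbol\varphi+s\boldsymbol J)_{\Omega_h}+(w,\nabla\cdot\boldsymbol q)_{\Omega_h}+(\boldsymbol\psi,\boldsymbol q+\nabla\cdot\boldsymbol\tau)_{\Omega_h}+(r\boldsymbol J,\boldsymbol\tau)_{\Omega_h}\\ &-\langle\hat w,\boldsymbol q\cdot\boldsymbol n\rangle_{\partial\Omega_h}-\langle\hat{\boldsymbol\psi},\boldsymbol\tau\boldsymbol n\rangle_{\partial\Omega_h}-\langle z,\hat V_n\rangle_{\partial\Omega_h}-\langle\boldsymbol\varphi,\hat{\boldsymbol M}_n\rangle_{\partial\Omega_h}. \end{aligned} \] \textbf{Lemma.} If $\boldsymbol u\in\mathcal U$ satisfies $\mathcal B(\boldsymbol u,\boldsymbol v)=0$ for every $\boldsymbol v\in\mathcal V$, then $\boldsymbol u=\boldsymbol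 0$: all nine components $\boldsymbol V,\boldsymbol M,w,\boldsymbol\psi,r,\hat w,\hat{\boldsymbol\psi},\hat V_n,\hat{\boldsymbol M}_n$ vanish. -/

import Mathlib

open MeasureTheory
open scoped ContDiff

noncomputable section

namespace ReissnerMindlin

/-! ## Domain and mesh -/

/-- The Euclidean plane. -/
abbrev Plane : Type := EuclideanSpace ℝ (Fin 2)

/-- A convex polygonal domain: a nonempty set which is the interior of the convex hull of finitely
many points. It is open, bounded and convex. -/
def IsConvexPolygonalDomain (Ω : Set Plane) : Prop :=
  Ω.Nonempty ∧ ∃ s : Finset Plane, Ω = interior (convexHull ℝ (s : Set Plane))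

/-- An open (nondegenerate) convex quadrilateral: the interior of the convex hull of four points
none of which lies in the convex hull of the other three. -/
def IsConvexQuad (K : Set Plane) : Prop :=
  ∃ p : Fin 4 → Plane, ConvexIndependent ℝ p ∧ K = interior (convexHull ℝ (Set.range p))

/-- A finite partition of `Ω` into convex quadrilaterals. Hanging nodes are allowed. -/
structure QuadMesh (Ω : Set Plane) where
  elems : Finset (Set Plane)
  isConvexQuad : ∀ K ∈ elems, IsConvexQuad K
  subset : ∀ K ∈ elems, K ⊆ Ω
  disjoint : ∀ K ∈ elems, ∀ K' ∈ elems, K ≠ K' → Disjoint K K'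
  cover : ⋃ K ∈ elems, closure K = closure Ω

/-! ## Lebesgue spaces -/

/-- The space `L₂(X)`. Vector fields are `Fin 2 → L2 X`, tensor fields `Fin 2 → Fin 2 → L2 X`
(the first index is the row). -/
abbrev L2 (X : Set Plane) : Type := Lp ℝ 2 (volume.restrict X)

/-- The restriction `f ↦ f|_K` from `L₂(Ω)` to `L₂(K)`, for `K ⊆ Ω`. -/
def restr {K Ω : Set Plane} (h : K ⊆ Ω) : L2 Ω →ₗ[ℝ] L2 K where
  toFun f := ((Lp.memLp f).mono_measure (Measure.restrict_mono_set volume h)).toLp f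
  map_add' f g := by
    rw [← MemLp.toLp_add]
    exact (MemLp.toLp_eq_toLp_iff _ _).2
      (ae_mono (Measure.restrict_mono_set volume h) (Lp.coeFn_add f g))
  map_smul' c f := by
    rw [RingHom.id_apply, ← MemLp.toLp_const_smul]
    exact (MemLp.toLp_eq_toLp_iff _ _).2
      (ae_mono (Measure.restrict_mono_set volume h) (Lp.coeFn_smul c f))

/-! ## Sobolev spaces through weak derivatives -/

/-- `φ` is a test function on `X`: smooth with compact support contained in `X`. -/
structure IsTestFunction (X : Set Plane) (φ : Plane → ℝ) : Prop where
  smooth : ContDiff ℝ ∞ φ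
  compact : HasCompactSupport φ
  supp : tsupport φ ⊆ X

/-- The classical partial derivative `∂φ/∂xᵢ`. -/
def partialD (i : Fin 2) (φ : Plane → ℝ) (x : Plane) : ℝ :=
  fderiv ℝ φ x (EuclideanSpace.single i 1)

/-- Carrier of the space `H¹`: a function together with its gradient. -/
abbrev GradPair (X : Set Plane) : Type := L2 X × (Fin 2 → L2 X)

/-- Carrier of the space `H(div)`: a vector field together with its divergence. -/
abbrev DivPair (X : Set Plane) : Type := (Fin 2 → L2 X) × L2 X

section TestFunctions

variable {X : Set Plane} {φ ψ : Plane → ℝ}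

theorem partialD_continuous (i : Fin 2) (hφ : ContDiff ℝ ∞ φ) : Continuous (partialD i φ) :=
  (hφ.continuous_fderiv (by simp)).clm_apply continuous_const

theorem partialD_compact (i : Fin 2) (hφ : HasCompactSupport φ) :
    HasCompactSupport (partialD i φ) :=
  hφ.fderiv_apply ℝ (EuclideanSpace.single i 1)

theorem IsTestFunction.memLp (hφ : IsTestFunction X φ) : MemLp φ 2 (volume.restrict X) :=
  (hφ.smooth.continuous.memLp_of_hasCompactSupport hφ.compact).restrict X

theorem IsTestFunction.memLp_partialD (hφ : IsTestFunction X φ) (i : Fin 2) :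
    MemLp (partialD i φ) 2 (volume.restrict X) :=
  ((partialD_continuous i hφ.smooth).memLp_of_hasCompactSupport
    (partialD_compact i hφ.compact)).restrict X

theorem IsTestFunction.zero : IsTestFunction X (0 : Plane → ℝ) :=
  ⟨contDiff_const, HasCompactSupport.zero, by simp [tsupport]⟩

theorem IsTestFunction.add (hφ : IsTestFunction X φ) (hψ : IsTestFunction X ψ) :
    IsTestFunction X (φ + ψ) :=
  ⟨hφ.smooth.add hψ.smooth, hφ.compact.add hψ.compact,
    (tsupport_add φ ψ).trans (Set.union_subset hφ.supp hψ.supp)⟩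

theorem IsTestFunction.smul (c : ℝ) (hφ : IsTestFunction X φ) : IsTestFunction X (c • φ) :=
  ⟨hφ.smooth.const_smul c, hφ.compact.smul_left (f := fun _ => c),
    (tsupport_smul_subset_right (fun _ => c) φ).trans hφ.supp⟩

theorem partialD_zero (i : Fin 2) : partialD i (0 : Plane → ℝ) = 0 := by
  funext x; simp [partialD]

theorem partialD_add (i : Fin 2) (hφ : ContDiff ℝ ∞ φ) (hψ : ContDiff ℝ ∞ ψ) :
    partialD i (φ + ψ) = partialD i φ + partialD i ψ := by
  funext x
  simp [partialD, fderiv_add ((hφ.differentiable (by simp)) x) ((hψ.differentiable (by simp)) x)]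

theorem partialD_smul (i : Fin 2) (c : ℝ) (hφ : ContDiff ℝ ∞ φ) :
    partialD i (c • φ) = c • partialD i φ := by
  funext x
  simp [partialD, fderiv_const_smul ((hφ.differentiable (by simp)) x) c]

end TestFunctions

section Linearity

variable {X : Set Plane} {φ : Plane → ℝ}

theorem integral_zero_mul : ∫ x in X, (0 : L2 X) x * φ x = 0 := by
  rw [integral_congr_ae (g := fun _ => (0 : ℝ))]
  · simp
  · filter_upwards [Lp.coeFn_zero ℝ 2 (volume.restrict X)] with x hx
    rw [hx]; simp

theorem integral_add_mul (f g : L2 X) (hφ : MemLp φ 2 (volume.restrict X)) :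
    ∫ x in X, (f + g : L2 X) x * φ x = (∫ x in X, f x * φ x) + ∫ x in X, g x * φ x := by
  have hf : Integrable (fun x => f x * φ x) (volume.restrict X) := (Lp.memLp f).integrable_mul hφ
  have hg : Integrable (fun x => g x * φ x) (volume.restrict X) := (Lp.memLp g).integrable_mul hφ
  rw [← integral_add hf hg]
  apply integral_congr_ae
  filter_upwards [Lp.coeFn_add f g] with x hx
  rw [hx, Pi.add_apply, add_mul]

theorem integral_smul_mul (c : ℝ) (f : L2 X) :
    ∫ x in X, (c • f : L2 X) x * φ x = c * ∫ x in X, f x * φ x := by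
  rw [← integral_const_mul]
  apply integral_congr_ae
  filter_upwards [Lp.coeFn_smul c f] with x hx
  rw [hx, Pi.smul_apply, smul_eq_mul, mul_assoc]

end Linearity

/-- The space `H¹(X)`: all pairs `(v, g)` with `v ∈ L₂(X)` whose weak gradient is `g ∈ L₂(X)²`. The
second component is determined by the first. -/
def H1 (X : Set Plane) : Submodule ℝ (GradPair X) where
  carrier := {p | ∀ φ : Plane → ℝ, IsTestFunction X φ → ∀ i : Fin 2,
    ∫ x in X, p.1 x * partialD i φ x = - ∫ x in X, p.2 i x * φ x}
  zero_mem' := by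
    intro φ _ i
    simp only [Prod.fst_zero, Prod.snd_zero, Pi.zero_apply, integral_zero_mul, neg_zero]
  add_mem' := by
    intro p q hp hq φ hφ i
    simp only [Prod.fst_add, Prod.snd_add, Pi.add_apply]
    rw [integral_add_mul _ _ (hφ.memLp_partialD i), integral_add_mul _ _ hφ.memLp, hp φ hφ i,
      hq φ hφ i, neg_add]
  smul_mem' := by
    intro c p hp φ hφ i
    simp only [Prod.smul_fst, Prod.smul_snd, Pi.smul_apply]
    rw [integral_smul_mul, integral_smul_mul, hp φ hφ i, mul_neg]

/-- The space `H(div, X)`: all pairs `(q, d)` with `q ∈ L₂(X)²` whose weak divergence is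
`d ∈ L₂(X)`. The second component is determined by the first. -/
def Hdiv (X : Set Plane) : Submodule ℝ (DivPair X) where
  carrier := {p | ∀ φ : Plane → ℝ, IsTestFunction X φ →
    ∑ i : Fin 2, ∫ x in X, p.1 i x * partialD i φ x = - ∫ x in X, p.2 x * φ x}
  zero_mem' := by
    intro φ _
    simp only [Prod.fst_zero, Prod.snd_zero, Pi.zero_apply, integral_zero_mul,
      Finset.sum_const_zero, neg_zero]
  add_mem' := by
    intro p q hp hq φ hφ
    simp only [Prod.fst_add, Prod.snd_add, Pi.add_apply]
    rw [Finset.sum_congr rfl fun i _ => integral_add_mul _ _ (hφ.memLp_partialD i),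
      Finset.sum_add_distrib, integral_add_mul _ _ hφ.memLp, hp φ hφ, hq φ hφ, neg_add]
  smul_mem' := by
    intro c p hp φ hφ
    simp only [Prod.smul_fst, Prod.smul_snd, Pi.smul_apply, integral_smul_mul]
    rw [← Finset.mul_sum, hp φ hφ, mul_neg]

/-- The test functions on `X`, each with its gradient, as a subspace of `L₂(X) × L₂(X)²`. -/
def testGraph (X : Set Plane) : Submodule ℝ (GradPair X) where
  carrier := {p | ∃ φ : Plane → ℝ, IsTestFunction X φ ∧
    p.1 =ᵐ[volume.restrict X] φ ∧ ∀ i : Fin 2, p.2 i =ᵐ[volume.restrict X] partialD i φ}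
  zero_mem' := by
    refine ⟨0, IsTestFunction.zero, Lp.coeFn_zero ℝ 2 _, fun i => ?_⟩
    rw [partialD_zero]
    exact Lp.coeFn_zero ℝ 2 _
  add_mem' := by
    rintro p q ⟨φ, hφ, h1, h2⟩ ⟨ψ, hψ, h3, h4⟩
    refine ⟨φ + ψ, hφ.add hψ, (Lp.coeFn_add p.1 q.1).trans (h1.add h3), fun i => ?_⟩
    rw [partialD_add i hφ.smooth hψ.smooth]
    exact (Lp.coeFn_add (p.2 i) (q.2 i)).trans ((h2 i).add (h4 i))
  smul_mem' := by
    rintro c p ⟨φ, hφ, h1, h2⟩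
    refine ⟨c • φ, hφ.smul c, (Lp.coeFn_smul c p.1).trans (h1.const_smul c), fun i => ?_⟩
    rw [partialD_smul i c hφ.smooth]
    exact (Lp.coeFn_smul c (p.2 i)).trans ((h2 i).const_smul c)

/-- The space `H¹₀(X)`: the closure of the test functions on `X` in the topology of `H¹(X)`, that is,
in the `L₂` topology of functions and their gradients. -/
def H10 (X : Set Plane) : Submodule ℝ (GradPair X) := (testGraph X).topologicalClosure

/-- Restriction of a function and its gradient to `K ⊆ Ω`. -/
def restrGrad {K Ω : Set Plane} (h : K ⊆ Ω) : GradPair Ω →ₗ[ℝ] GradPair K :=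
  (restr h).prodMap ((restr h).compLeft (Fin 2))

/-- Restriction of a vector field and its divergence to `K ⊆ Ω`. -/
def restrDiv {K Ω : Set Plane} (h : K ⊆ Ω) : DivPair Ω →ₗ[ℝ] DivPair K :=
  ((restr h).compLeft (Fin 2)).prodMap (restr h)

/-! ## The boundary pairing on one element -/

/-- The pairing `⟨v, q · n⟩_{1/2, ∂K} = (∇v, q)_K + (v, ∇ · q)_K` of the trace of `v ∈ H¹(K)` with the
outward normal trace of `q ∈ H(div, K)`. -/
def bdryPairing (K : Set Plane) : GradPair K →ₗ[ℝ] DivPair K →ₗ[ℝ] ℝ :=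
  LinearMap.mk₂ ℝ (fun v q => (∑ i : Fin 2, inner ℝ (v.2 i) (q.1 i)) + inner ℝ v.1 q.2)
    (by intro v v' q; simp [inner_add_left, Finset.sum_add_distrib]; ring)
    (by intro c v q; simp [inner_smul_left]; ring)
    (by intro v q q'; simp [inner_add_right, Finset.sum_add_distrib]; ring)
    (by intro c v q; simp [inner_smul_right]; ring)

theorem bdryPairing_apply (K : Set Plane) (v : GradPair K) (q : DivPair K) :
    bdryPairing K v q = (∑ i : Fin 2, inner ℝ (v.2 i) (q.1 i)) + inner ℝ v.1 q.2 := rfl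

/-- Functions with zero trace do not contribute to the boundary pairing. -/
theorem bdryPairing_eq_zero {K : Set Plane} {v : GradPair K} (hv : v ∈ H10 K) {q : DivPair K}
    (hq : q ∈ Hdiv K) : bdryPairing K v q = 0 := by
  have hcont : Continuous fun v : GradPair K => bdryPairing K v q := by
    simp only [bdryPairing_apply]
    fun_prop
  have hclosed : IsClosed {v : GradPair K | bdryPairing K v q = 0} :=
    isClosed_eq hcont continuous_const
  have hsub : (testGraph K : Set (GradPair K)) ⊆ {v : GradPair K | bdryPairing K v q = 0} := by
    rintro p ⟨φ, hφ, h1, h2⟩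
    have e1 : ∀ i : Fin 2, inner ℝ (p.2 i) (q.1 i) = ∫ x in K, q.1 i x * partialD i φ x := by
      intro i
      rw [L2.inner_def]
      apply integral_congr_ae
      filter_upwards [h2 i] with x hx
      rw [hx]; simp
    have e2 : inner ℝ p.1 q.2 = ∫ x in K, q.2 x * φ x := by
      rw [L2.inner_def]
      apply integral_congr_ae
      filter_upwards [h1] with x hx
      rw [hx]; simp
    show bdryPairing K p q = 0
    rw [bdryPairing_apply, e2, Finset.sum_congr rfl fun i _ => e1 i, hq φ hφ]
    ring
  exact closure_minimal hsub hclosed hv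

/-! ## Broken spaces and skeleton spaces -/

variable {Ω : Set Plane}

/-- The broken space `H¹(Ω_h)`: functions in `L₂(Ω)`, with their elementwise gradients, that belong to
`H¹(K)` on every element `K`. -/
def brokenH1 (T : QuadMesh Ω) : Submodule ℝ (GradPair Ω) :=
  ⨅ K : T.elems, (H1 (K : Set Plane)).comap (restrGrad (T.subset K K.2))

/-- The broken space `H(div, Ω_h)`: vector fields in `L₂(Ω)²`, with their elementwise divergences,
that belong to `H(div, K)` on every element `K`. -/
def brokenHdiv (T : QuadMesh Ω) : Submodule ℝ (DivPair Ω) :=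
  ⨅ K : T.elems, (Hdiv (K : Set Plane)).comap (restrDiv (T.subset K K.2))

/-- Restriction of functions in `H¹₀(Ω)`, with their gradients, to one element. -/
def restrH10 (T : QuadMesh Ω) (K : T.elems) : H10 Ω →ₗ[ℝ] GradPair (K : Set Plane) :=
  (restrGrad (T.subset K K.2)).comp (H10 Ω).subtype

/-- Restriction of vector fields in `H(div, Ω)`, with their divergences, to one element. -/
def restrHdiv (T : QuadMesh Ω) (K : T.elems) : Hdiv Ω →ₗ[ℝ] DivPair (K : Set Plane) :=
  (restrDiv (T.subset K K.2)).comp (Hdiv Ω).subtype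

/-- The restriction of `z ∈ H¹(Ω_h)` to one element, as a member of `H¹(K)`. -/
def restrBrokenH1 (T : QuadMesh Ω) (K : T.elems) (z : brokenH1 T) : H1 (K : Set Plane) :=
  ⟨restrGrad (T.subset K K.2) z, Submodule.mem_comap.1 ((Submodule.mem_iInf _).1 z.2 K)⟩

/-- The restriction of `q ∈ H(div, Ω_h)` to one element, as a member of `H(div, K)`. -/
def restrBrokenHdiv (T : QuadMesh Ω) (K : T.elems) (q : brokenHdiv T) : Hdiv (K : Set Plane) :=
  ⟨restrDiv (T.subset K K.2) q, Submodule.mem_comap.1 ((Submodule.mem_iInf _).1 q.2 K)⟩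

/-- The functions in `H¹₀(Ω)` whose trace vanishes on the boundary of every element, that is, whose
restriction to every element `K` belongs to `H¹₀(K)`. -/
def traceKer (T : QuadMesh Ω) : Submodule ℝ (H10 Ω) :=
  ⨅ K : T.elems, (H10 (K : Set Plane)).comap (restrH10 T K)

/-- The space `H₀^{1/2}(∂Ω_h)` of traces on the skeleton of functions in `H¹₀(Ω)`: two functions have
the same trace iff their difference has zero trace on the boundary of every element. -/
abbrev SkeletonTrace (T : QuadMesh Ω) : Type := H10 Ω ⧸ traceKer T

/-- The vector fields in `H(div, Ω)` whose normal trace vanishes, as a functional on `H¹(K)`, on the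
boundary of every element `K`. -/
def normalTraceKer (T : QuadMesh Ω) : Submodule ℝ (Hdiv Ω) :=
  ⨅ K : T.elems, ⨅ z : H1 (K : Set Plane),
    LinearMap.ker ((bdryPairing (K : Set Plane) z).comp (restrHdiv T K))

/-- The space `H^{-1/2}(∂Ω_h)` of normal traces on the skeleton of vector fields in `H(div, Ω)`: two
fields have the same normal trace iff their normal traces agree on the boundary of every element. -/
abbrev SkeletonFlux (T : QuadMesh Ω) : Type := Hdiv Ω ⧸ normalTraceKer T

theorem traceKer_le (T : QuadMesh Ω) (K : T.elems) (q : Hdiv (K : Set Plane)) :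
    traceKer T ≤
      LinearMap.ker (((bdryPairing (K : Set Plane)).flip q).comp (restrH10 T K)) := by
  intro v hv
  have h : restrH10 T K v ∈ H10 (K : Set Plane) :=
    Submodule.mem_comap.1 ((Submodule.mem_iInf _).1 hv K)
  rw [LinearMap.mem_ker, LinearMap.comp_apply, LinearMap.flip_apply]
  exact bdryPairing_eq_zero h q.2

theorem normalTraceKer_le (T : QuadMesh Ω) (K : T.elems) (z : H1 (K : Set Plane)) :
    normalTraceKer T ≤ LinearMap.ker ((bdryPairing (K : Set Plane) z).comp (restrHdiv T K)) :=
  (iInf_le _ K).trans (iInf_le _ z)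

/-- The pairing `⟨ŵ, q · n⟩_{1/2, ∂K}` of a skeleton trace `ŵ` with `q ∈ H(div, K)`: the boundary
pairing of `q` with any `v ∈ H¹₀(Ω)` whose trace is `ŵ`. -/
def tracePairing (T : QuadMesh Ω) (K : T.elems) (q : Hdiv (K : Set Plane)) :
    SkeletonTrace T →ₗ[ℝ] ℝ :=
  (traceKer T).liftQ (((bdryPairing (K : Set Plane)).flip q).comp (restrH10 T K))
    (traceKer_le T K q)

/-- The pairing `⟨z, V̂_n⟩_{1/2, ∂K}` of `z ∈ H¹(K)` with a skeleton flux `V̂_n`: the boundary pairing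
of `z` with any `η ∈ H(div, Ω)` whose normal trace is `V̂_n`. -/
def fluxPairing (T : QuadMesh Ω) (K : T.elems) (z : H1 (K : Set Plane)) :
    SkeletonFlux T →ₗ[ℝ] ℝ :=
  (normalTraceKer T).liftQ ((bdryPairing (K : Set Plane) z).comp (restrHdiv T K))
    (normalTraceKer_le T K z)

/-! ## The ultra-weak formulation -/

/-- The trial space `U`, with elements `(V, M, w, ψ, r, ŵ, ψ̂, V̂_n, M̂_n)`. -/
structure Trial (T : QuadMesh Ω) where
  V : Fin 2 → L2 Ω
  M : Fin 2 → Fin 2 → L2 Ω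
  w : L2 Ω
  ψ : Fin 2 → L2 Ω
  r : L2 Ω
  wHat : SkeletonTrace T
  ψHat : Fin 2 → SkeletonTrace T
  VHat : SkeletonFlux T
  MHat : Fin 2 → SkeletonFlux T

/-- The test space `V`, with elements `(q, τ, z, φ, s)`. -/
structure Test (T : QuadMesh Ω) where
  q : brokenHdiv T
  τ : Fin 2 → brokenHdiv T
  z : brokenH1 T
  φ : Fin 2 → brokenH1 T
  s : L2 Ω

namespace Test

variable {T : QuadMesh Ω} (v : Test T)

/-- The vector field `q`. -/
def qField : Fin 2 → L2 Ω := v.q.1.1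

/-- The elementwise divergence of `q`. -/
def divq : L2 Ω := v.q.1.2

/-- The tensor field `τ`. -/
def τField : Fin 2 → Fin 2 → L2 Ω := fun i => (v.τ i).1.1

/-- The elementwise, row-wise divergence of `τ`. -/
def divτ : Fin 2 → L2 Ω := fun i => (v.τ i).1.2

/-- The elementwise gradient of `z`. -/
def gradz : Fin 2 → L2 Ω := v.z.1.2

/-- The vector field `φ`. -/
def φField : Fin 2 → L2 Ω := fun i => (v.φ i).1.1

/-- The elementwise gradient of `φ`; its row `i` is the gradient of `φ i`. -/
def gradφ : Fin 2 → Fin 2 → L2 Ω := fun i => (v.φ i).1.2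

end Test

/-- The matrix `J`. -/
def J : Matrix (Fin 2) (Fin 2) ℝ := !![0, 1; -1, 0]

/-- The tensor field `r J`. -/
def mulJ (r : L2 Ω) : Fin 2 → Fin 2 → L2 Ω := fun i j => J i j • r

/-- The compliance tensor `τ ↦ 6 (τ - ν / (1 + ν) tr(τ) I)`. -/
def compliance (ν : ℝ) (τ : Fin 2 → Fin 2 → L2 Ω) : Fin 2 → Fin 2 → L2 Ω :=
  fun i j => (6 : ℝ) • (τ i j - (ν / (1 + ν)) • (if i = j then ∑ k, τ k k else 0))

/-- `(f, g)_{Ω_h}`, the sum over the elements of the `L₂(K)` inner products of scalar functions. -/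
def scp (T : QuadMesh Ω) (f g : L2 Ω) : ℝ :=
  ∑ K : T.elems, inner ℝ (restr (T.subset K K.2) f) (restr (T.subset K K.2) g)

/-- `(f, g)_{Ω_h}` for vector fields. -/
def scpVec (T : QuadMesh Ω) (f g : Fin 2 → L2 Ω) : ℝ := ∑ i, scp T (f i) (g i)

/-- `(f, g)_{Ω_h}` for tensor fields. -/
def scpTen (T : QuadMesh Ω) (f g : Fin 2 → Fin 2 → L2 Ω) : ℝ := ∑ i, ∑ j, scp T (f i j) (g i j)

/-- The bilinear form `B(u, v)` of the hybrid ultra-weak formulation, with shear correction factor `κ`,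
thickness `t` and Poisson ratio `ν`. -/
def B (T : QuadMesh Ω) (κ t ν : ℝ) (u : Trial T) (v : Test T) : ℝ :=
  scpVec T u.V ((κ⁻¹ * t ^ 2) • v.qField + v.gradz - v.φField)
    + scpTen T u.M (compliance ν v.τField + v.gradφ + mulJ v.s)
    + scp T u.w v.divq
    + scpVec T u.ψ (v.qField + v.divτ)
    + scpTen T (mulJ u.r) v.τField
    - ∑ K : T.elems, tracePairing T K (restrBrokenHdiv T K v.q) u.wHat
    - ∑ K : T.elems, ∑ i, tracePairing T K (restrBrokenHdiv T K (v.τ i)) (u.ψHat i)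
    - ∑ K : T.elems, fluxPairing T K (restrBrokenH1 T K v.z) u.VHat
    - ∑ K : T.elems, ∑ i, fluxPairing T K (restrBrokenH1 T K (v.φ i)) (u.MHat i)

end ReissnerMindlin

end

noncomputable section

namespace ReissnerMindlin

/-! ## Duality between `H¹₀` and `H(div)` -/

/-! Everything rests on the pairing `bdryPairing` `(∇v, q) + (v, ∇ · q)`. It is defined for
arbitrary pairs in `L₂`, and `H¹₀` and `H(div)` are each other's annihilators in it. One inclusion
is Hahn–Banach with Riesz representation (`mem_H10_of_bdryPairing_eq_zero`), the other is the
definition of the weak divergence.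

Choose global representatives `W, Ψ ∈ H¹₀(Ω)` and `η, μ ∈ H(div, Ω)` of the skeleton unknowns. The
element pairings then add up to pairings on `Ω`. Grouped by test component (`B_eq`), `B(u, v) = 0`
says that the pair `(w, c V + ψ)`, with `c = κ⁻¹ t²`, pairs with every broken field as `W` does, and
similarly for the pairs `(ψᵢ, (C⁻¹M + rJ)ᵢ)`, `(V, 0)` and `(Mᵢ, -Vᵢ)`. It also says that `M` is
symmetric.

With conforming tests the representatives drop out. By the annihilator relations `w, ψ ∈ H¹₀(Ω)`
with `∇w = c V + ψ`, `∇ψ = C⁻¹M + rJ`, `∇ · V = 0`, `∇ · M = -V`. Pairing `w` with `V` and `ψ` with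
`M` and adding gives `c ‖V‖² + (C⁻¹M, M) = 0`, so `V = M = 0`. Then `∇ψ = rJ`; pairing `ψ₀` with the
rotated gradient of `ψ₁` gives `‖r‖² = 0`. An `H¹₀` function with zero gradient vanishes, so `ψ = 0`
and then `w = 0`.

Finally each representative pairs to zero with all broken tests. Tests supported on one element show
that its trace vanishes there. -/

theorem inner_eq_integral_mul {X : Set Plane} (f g : L2 X) :
    inner ℝ f g = ∫ x in X, g x * f x := by
  rw [L2.inner_def]
  rfl

/-- Integration of a product with a function that agrees almost everywhere with an `L₂` function. -/
theorem inner_eq_integral_mul_of_ae {X : Set Plane} {f g : L2 X} {φ : Plane → ℝ}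
    (h : f =ᵐ[volume.restrict X] φ) : inner ℝ f g = ∫ x in X, g x * φ x := by
  rw [inner_eq_integral_mul]
  apply integral_congr_ae
  filter_upwards [h] with x hx
  rw [hx]

/-! ### Test functions, their classes in `L₂`, and integration by parts -/

namespace IsTestFunction

variable {X : Set Plane} {φ ψ : Plane → ℝ}

theorem mono {Y : Set Plane} (h : X ⊆ Y) (hφ : IsTestFunction X φ) : IsTestFunction Y φ :=
  ⟨hφ.smooth, hφ.compact, hφ.supp.trans h⟩

theorem eq_zero_of_notMem (hφ : IsTestFunction X φ) {x : Plane} (hx : x ∉ X) : φ x = 0 :=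
  image_eq_zero_of_notMem_tsupport fun h => hx (hφ.supp h)

theorem smooth_partialD (i : Fin 2) (hφ : ContDiff ℝ ∞ φ) : ContDiff ℝ ∞ (partialD i φ) :=
  (hφ.fderiv_right (m := ∞) (by simp)).clm_apply contDiff_const

theorem partialD (i : Fin 2) (hφ : IsTestFunction X φ) : IsTestFunction X (partialD i φ) :=
  ⟨smooth_partialD i hφ.smooth, partialD_compact i hφ.compact,
    (tsupport_fderiv_apply_subset ℝ _).trans hφ.supp⟩

theorem smooth_mul {a : Plane → ℝ} (ha : ContDiff ℝ ∞ a) (hφ : IsTestFunction X φ) :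
    IsTestFunction X (fun x => a x * φ x) :=
  ⟨ha.mul hφ.smooth, hφ.compact.mul_left, (tsupport_mul_subset_right).trans hφ.supp⟩

/-- Integration by parts for test functions. -/
theorem integral_mul_partialD (hφ : IsTestFunction X φ) (hψ : IsTestFunction X ψ) (i : Fin 2) :
    ∫ x in X, φ x * ReissnerMindlin.partialD i ψ x =
      - ∫ x in X, ReissnerMindlin.partialD i φ x * ψ x := by
  -- Both integrands vanish off `X`, so the identity reduces to the whole plane and needs no
  -- regularity of `X`.
  rw [setIntegral_eq_integral_of_forall_compl_eq_zero
      (fun x hx => by rw [hφ.eq_zero_of_notMem hx, zero_mul]),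
    setIntegral_eq_integral_of_forall_compl_eq_zero
      (fun x hx => by rw [hψ.eq_zero_of_notMem hx, mul_zero])]
  have hc := hφ.smooth.continuous
  have hc' := hψ.smooth.continuous
  have hd := partialD_continuous i hφ.smooth
  have hd' := partialD_continuous i hψ.smooth
  exact integral_mul_fderiv_eq_neg_fderiv_mul_of_integrable
    ((hd.mul hc').integrable_of_hasCompactSupport hψ.compact.mul_left)
    ((hc.mul hd').integrable_of_hasCompactSupport hφ.compact.mul_right)
    ((hc.mul hc').integrable_of_hasCompactSupport hφ.compact.mul_right)
    (fun x _ => hφ.smooth.differentiable (by simp) x)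
    (fun x _ => hψ.smooth.differentiable (by simp) x)

/-- The class in `L₂` of a test function. -/
def toL2 (hφ : IsTestFunction X φ) : L2 X := hφ.memLp.toLp φ

theorem coeFn_toL2 (hφ : IsTestFunction X φ) : hφ.toL2 =ᵐ[volume.restrict X] φ :=
  hφ.memLp.coeFn_toLp

/-- A test function with its gradient. -/
def gradPair (hφ : IsTestFunction X φ) : GradPair X := (hφ.toL2, fun i => (hφ.partialD i).toL2)

theorem gradPair_mem (hφ : IsTestFunction X φ) : hφ.gradPair ∈ testGraph X :=
  ⟨φ, hφ, hφ.coeFn_toL2, fun i => (hφ.partialD i).coeFn_toL2⟩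

theorem bdryPairing_gradPair (hφ : IsTestFunction X φ) (q : DivPair X) :
    bdryPairing X hφ.gradPair q =
      (∑ i, ∫ x in X, q.1 i x * ReissnerMindlin.partialD i φ x) + ∫ x in X, q.2 x * φ x := by
  rw [bdryPairing_apply, gradPair, inner_eq_integral_mul_of_ae hφ.coeFn_toL2,
    Finset.sum_congr rfl fun i _ => inner_eq_integral_mul_of_ae (hφ.partialD i).coeFn_toL2]

end IsTestFunction

/-- The weak divergence identity is exactly orthogonality to test functions, which makes `H(div)` an
annihilator. -/
theorem mem_Hdiv_iff {X : Set Plane} {q : DivPair X} :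
    q ∈ Hdiv X ↔ ∀ (φ : Plane → ℝ) (hφ : IsTestFunction X φ),
      bdryPairing X hφ.gradPair q = 0 := by
  simp only [IsTestFunction.bdryPairing_gradPair, add_eq_zero_iff_eq_neg]
  rfl

/-- `H¹₀` is the annihilator of `H(div)` in the boundary pairing. -/
theorem mem_H10_of_bdryPairing_eq_zero {X : Set Plane} {p : GradPair X}
    (h : ∀ q ∈ Hdiv X, bdryPairing X p q = 0) : p ∈ H10 X := by
  by_contra hp
  obtain ⟨f, c, hf, hc⟩ := geometric_hahn_banach_closed_point (H10 X).convex
    (testGraph X).isClosed_topologicalClosure hp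
  -- A functional bounded above on a subspace vanishes there: otherwise a multiple of `a` would
  -- attain the forbidden value `c`.
  have hf0 : ∀ a ∈ H10 X, f a = 0 := by
    intro a ha
    by_contra hne
    have := hf ((c / f a) • a) ((H10 X).smul_mem _ ha)
    rw [map_smul, smul_eq_mul, div_mul_cancel₀ _ hne] at this
    exact lt_irrefl _ this
  have hc0 : 0 < c := by simpa using hf 0 (H10 X).zero_mem
  let f1 : L2 X →L[ℝ] ℝ := f.comp (ContinuousLinearMap.inl ℝ _ _)
  let f2 : Fin 2 → L2 X →L[ℝ] ℝ := fun i =>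
    (f.comp (ContinuousLinearMap.inr ℝ (L2 X) (Fin 2 → L2 X))).comp
      (ContinuousLinearMap.single ℝ (fun _ : Fin 2 => L2 X) i)
  -- The Riesz representatives of the components of `f` form a pair that represents `f` in the
  -- boundary pairing. Since `f` kills test functions, it lies in `H(div)`, so the hypothesis gives
  -- `f p = 0`, against `0 < c < f p`.
  let q : DivPair X := (fun i => (InnerProductSpace.toDual ℝ (L2 X)).symm (f2 i),
    (InnerProductSpace.toDual ℝ (L2 X)).symm f1)
  have key : ∀ a, bdryPairing X a q = f a := by
    intro a
    have e1 : ∀ i, inner ℝ (a.2 i) (q.1 i) = f2 i (a.2 i) := fun i => by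
      rw [real_inner_comm]; exact InnerProductSpace.toDual_symm_apply
    have e2 : inner ℝ a.1 q.2 = f1 a.1 := by
      rw [real_inner_comm]; exact InnerProductSpace.toDual_symm_apply
    rw [bdryPairing_apply, e2]
    simp only [e1, f1, f2, ContinuousLinearMap.comp_apply, ContinuousLinearMap.inl_apply,
      ContinuousLinearMap.inr_apply, ContinuousLinearMap.single_apply]
    rw [← map_sum, ← map_add]
    congr 1
    refine Prod.ext ?_ ?_
    · simp
    · simpa using Finset.univ_sum_single a.2
  have hq : q ∈ Hdiv X := mem_Hdiv_iff.2 fun φ hφ => by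
    rw [key]
    exact hf0 _ (subset_closure hφ.gradPair_mem)
  rw [← key, h q hq] at hc
  exact lt_asymm hc hc0

/-- The field `φ eᵢ` has divergence `∂ᵢφ`. Pairing with it recovers the definition of the weak
derivative in direction `i`. -/
theorem mem_Hdiv_single {X : Set Plane} {φ : Plane → ℝ} (hφ : IsTestFunction X φ) (i : Fin 2) :
    ((Pi.single i hφ.toL2, (hφ.partialD i).toL2) : DivPair X) ∈ Hdiv X := by
  refine mem_Hdiv_iff.2 fun ψ hψ => ?_
  rw [bdryPairing_apply, Finset.sum_eq_single i (fun j _ hj => by simp [hj]) (by simp)]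
  simp only [Pi.single_eq_same]
  rw [real_inner_comm, inner_eq_integral_mul_of_ae hφ.coeFn_toL2,
    show hψ.gradPair.1 = hψ.toL2 from rfl, inner_eq_integral_mul_of_ae hψ.coeFn_toL2]
  have h1 : ∫ x in X, (hψ.gradPair.2 i) x * φ x = ∫ x in X, partialD i ψ x * φ x := by
    apply integral_congr_ae
    filter_upwards [(hψ.partialD i).coeFn_toL2] with x hx
    exact congrArg (· * φ x) hx
  have h2 : ∫ x in X, ((hφ.partialD i).toL2 : L2 X) x * ψ x = ∫ x in X, partialD i φ x * ψ x := by
    apply integral_congr_ae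
    filter_upwards [(hφ.partialD i).coeFn_toL2] with x hx
    rw [hx]
  rw [h1, h2]
  have h3 := hφ.integral_mul_partialD hψ i
  simp only [mul_comm (partialD i ψ _)]
  rw [h3, neg_add_cancel]

theorem H10_le_H1 (X : Set Plane) : H10 X ≤ H1 X := by
  intro p hp φ hφ i
  have h := bdryPairing_eq_zero hp (mem_Hdiv_single hφ i)
  rw [bdryPairing_apply, Finset.sum_eq_single i (fun j _ hj => by simp [hj]) (by simp)] at h
  simp only [Pi.single_eq_same] at h
  rw [real_inner_comm, inner_eq_integral_mul_of_ae hφ.coeFn_toL2, real_inner_comm,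
    inner_eq_integral_mul_of_ae (hφ.partialD i).coeFn_toL2] at h
  linarith

/-- The rotated gradient of an `H¹` function is divergence free. -/
theorem rotGrad_mem_Hdiv {X : Set Plane} {p : GradPair X} (hp : p ∈ H1 X) :
    ((![p.2 1, -p.2 0], 0) : DivPair X) ∈ Hdiv X := by
  intro φ hφ
  -- The weak gradient identities are tested with `∂₀φ` and `∂₁φ`; equality of mixed partials
  -- identifies their left-hand sides.
  have h0 := hp _ (hφ.partialD 0) 1
  have h1 := hp _ (hφ.partialD 1) 0
  have hcomm : partialD 1 (partialD 0 φ) = partialD 0 (partialD 1 φ) := by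
    funext x
    have hd : DifferentiableAt ℝ (fderiv ℝ φ) x :=
      (hφ.smooth.fderiv_right (m := ∞) (by simp)).differentiable (by simp) x
    have e : ∀ i j : Fin 2, partialD i (partialD j φ) x =
        fderiv ℝ (fderiv ℝ φ) x (EuclideanSpace.single i 1) (EuclideanSpace.single j 1) := by
      intro i j
      unfold partialD
      rw [fderiv_clm_apply hd (differentiableAt_const _)]
      simp
    rw [e, e]
    exact (hφ.smooth.contDiffAt.isSymmSndFDerivAt
      (by simpa using WithTop.coe_le_coe.2 (le_top : (2 : ℕ∞) ≤ ⊤))).eq _ _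
  rw [hcomm, h1] at h0
  have h2 := integral_smul_mul (-1) (p.2 0) (φ := partialD 1 φ)
  simp only [Fin.sum_univ_two, Matrix.cons_val_zero, Matrix.cons_val_one, integral_zero_mul]
  rw [neg_one_smul] at h2
  rw [h2]
  linarith

/-- A function in `H¹₀` of a bounded set whose gradient vanishes is zero. -/
theorem eq_zero_of_mem_H10_of_grad_eq_zero {X : Set Plane} (hX : Bornology.IsBounded X)
    (hXm : MeasurableSet X) {f : L2 X} (hf : ((f, 0) : GradPair X) ∈ H10 X) : f = 0 := by
  have hf1 := H10_le_H1 X hf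
  obtain ⟨R, hR⟩ := hX.exists_norm_le
  have hsm : ContDiff ℝ ∞ (fun x : Plane => x 0) := by fun_prop
  -- In place of a Poincaré inequality: as `∇f = 0`, the field `(x₀ f, 0)` has divergence `f`, and
  -- its pairing with `(f, 0)` is `‖f‖²`. Boundedness of `X` puts `x₀ f` in `L₂`.
  have hbd : ∀ᵐ x ∂volume.restrict X, ‖(fun x : Plane => x 0) x * f x‖ ≤ R * ‖f x‖ := by
    filter_upwards [ae_restrict_mem hXm] with x hx
    rw [norm_mul]
    gcongr
    exact (PiLp.norm_apply_le x 0).trans (hR x hx)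
  have hmem : MemLp (fun x : Plane => x 0 * f x) 2 (volume.restrict X) :=
    (Lp.memLp f).of_le_mul
      (hsm.continuous.aestronglyMeasurable.mul (Lp.aestronglyMeasurable f)) hbd
  have hq : ((Pi.single 0 (hmem.toLp _), f) : DivPair X) ∈ Hdiv X := by
    intro φ hφ
    have hs := IsTestFunction.smooth_mul hsm hφ
    -- Testing `∂₀f = 0` with `x₀ φ` yields `∫ f φ + ∫ f x₀ ∂₀φ = 0`, the divergence identity
    -- sought.
    have h := hf1 _ hs 0
    have hpd : ∀ x, partialD 0 (fun x : Plane => x 0 * φ x) x = φ x + x 0 * partialD 0 φ x := by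
      intro x
      have h1 : HasFDerivAt (fun x : Plane => x 0) (EuclideanSpace.proj (𝕜 := ℝ) 0 : Plane →L[ℝ] ℝ) x :=
        (EuclideanSpace.proj (𝕜 := ℝ) 0 : Plane →L[ℝ] ℝ).hasFDerivAt
      have h2 := (hφ.smooth.differentiable (by simp) x).hasFDerivAt
      unfold partialD
      rw [HasFDerivAt.fderiv (h1.fun_mul h2)]
      simp [add_comm]
    rw [show (((f, 0) : GradPair X).2 0) = 0 from rfl, integral_zero_mul, neg_zero] at h
    simp only [hpd, mul_add] at h
    have hi1 : Integrable (fun x => f x * φ x) (volume.restrict X) :=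
      (Lp.memLp f).integrable_mul hφ.memLp
    have hi2 : Integrable (fun x => f x * (x 0 * partialD 0 φ x)) (volume.restrict X) :=
      (Lp.memLp f).integrable_mul (IsTestFunction.smooth_mul hsm (hφ.partialD 0)).memLp
    rw [integral_add hi1 hi2] at h
    rw [Finset.sum_eq_single 0 (fun j _ hj => by
      simp only [Pi.single_eq_of_ne hj, integral_zero_mul]) (by simp)]
    simp only [Pi.single_eq_same]
    have e : ∫ x in X, (hmem.toLp _ : L2 X) x * partialD 0 φ x =
        ∫ x in X, f x * (x 0 * partialD 0 φ x) := by
      apply integral_congr_ae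
      filter_upwards [hmem.coeFn_toLp] with x hx
      rw [hx]; ring
    rw [e]
    linarith
  have h := bdryPairing_eq_zero hf hq
  rw [bdryPairing_apply] at h
  simpa using h

variable {Ω : Set Plane}

/-! ## Geometry of the mesh -/

theorem IsConvexPolygonalDomain.isOpen (hΩ : IsConvexPolygonalDomain Ω) : IsOpen Ω := by
  obtain ⟨-, s, rfl⟩ := hΩ
  exact isOpen_interior

theorem IsConvexPolygonalDomain.isBounded (hΩ : IsConvexPolygonalDomain Ω) :
    Bornology.IsBounded Ω := by
  obtain ⟨-, s, rfl⟩ := hΩ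
  exact (isBounded_convexHull.2 s.finite_toSet.isBounded).subset interior_subset

namespace QuadMesh

variable (T : QuadMesh Ω)

theorem isOpen (K : T.elems) : IsOpen (K : Set Plane) := by
  obtain ⟨p, -, h⟩ := T.isConvexQuad K K.2
  rw [h]
  exact isOpen_interior

theorem convex (K : T.elems) : Convex ℝ (K : Set Plane) := by
  obtain ⟨p, -, h⟩ := T.isConvexQuad K K.2
  rw [h]
  exact (convex_convexHull ℝ _).interior

theorem pairwise_disjoint :
    Pairwise (Function.onFun Disjoint fun K : T.elems => (K : Set Plane)) :=
  fun K K' h => T.disjoint _ K.2 _ K'.2 fun e => h (Subtype.ext e)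

/-- The elements cover the domain up to a null set. -/
theorem iUnion_ae_eq : (⋃ K : T.elems, (K : Set Plane)) =ᵐ[volume] Ω := by
  refine Filter.EventuallyLE.antisymm
    (Set.iUnion_subset fun K : T.elems => T.subset _ K.2).eventuallyLE ?_
  -- Convex sets have null frontiers, and a point of some `closure K` off the frontier of `K` lies
  -- in `K`.
  have hfr : ∀ᵐ x ∂(volume : Measure Plane), ∀ K : T.elems, x ∉ frontier (K : Set Plane) :=
    ae_all_iff.2 fun K => measure_eq_zero_iff_ae_notMem.1 ((T.convex K).addHaar_frontier volume)
  filter_upwards [hfr] with x hx hxΩ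
  have hc : x ∈ ⋃ K ∈ T.elems, closure K := T.cover ▸ subset_closure hxΩ
  obtain ⟨K, hK, hxK⟩ := Set.mem_iUnion₂.1 hc
  refine Set.mem_iUnion.2 ⟨⟨K, hK⟩, ?_⟩
  by_contra h
  exact hx ⟨K, hK⟩ ⟨hxK, fun h' => h (interior_subset h')⟩

end QuadMesh

/-! ## Restriction and extension by zero -/

theorem coeFn_restr {K : Set Plane} (h : K ⊆ Ω) (f : L2 Ω) :
    restr h f =ᵐ[volume.restrict K] f :=
  ((Lp.memLp f).mono_measure (Measure.restrict_mono_set volume h)).coeFn_toLp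

/-- The elements are disjoint and fill `Ω` up to a null set, so the mesh disappears from all volume
terms. -/
theorem scp_eq_inner (T : QuadMesh Ω) (f g : L2 Ω) : scp T f g = inner ℝ f g := by
  have hint : IntegrableOn (fun x => g x * f x) Ω :=
    (Lp.memLp g).integrable_mul (Lp.memLp f)
  rw [inner_eq_integral_mul, ← setIntegral_congr_set T.iUnion_ae_eq,
    integral_iUnion_fintype (fun K => (T.isOpen K).measurableSet) T.pairwise_disjoint
      fun K => hint.mono_set (T.subset K K.2)]
  refine Finset.sum_congr rfl fun K _ => ?_
  rw [inner_eq_integral_mul]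
  apply integral_congr_ae
  filter_upwards [coeFn_restr (T.subset K K.2) f, coeFn_restr (T.subset K K.2) g] with x h1 h2
  rw [h1, h2]

/-- The boundary pairing on the domain is the sum of those on the elements. -/
theorem sum_bdryPairing (T : QuadMesh Ω) (p : GradPair Ω) (q : DivPair Ω) :
    ∑ K : T.elems, bdryPairing (K : Set Plane) (restrGrad (T.subset K K.2) p)
      (restrDiv (T.subset K K.2) q) = bdryPairing Ω p q := by
  simp only [bdryPairing_apply, ← scp_eq_inner T, scp]
  rw [Finset.sum_comm, ← Finset.sum_add_distrib]
  rfl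

theorem memLp_indicator {K : Set Plane} (h : K ⊆ Ω) (hK : MeasurableSet K) (f : L2 K) :
    MemLp (K.indicator f) 2 (volume.restrict Ω) := by
  rw [memLp_indicator_iff_restrict hK, Measure.restrict_restrict hK,
    Set.inter_eq_self_of_subset_left h]
  exact Lp.memLp f

/-- Extension by zero of an `L₂` function. -/
def extend {K : Set Plane} (h : K ⊆ Ω) (hK : MeasurableSet K) (f : L2 K) : L2 Ω :=
  (memLp_indicator h hK f).toLp _

theorem restr_extend {K : Set Plane} (h : K ⊆ Ω) (hK : MeasurableSet K) (f : L2 K) :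
    restr h (extend h hK f) = f := by
  apply Lp.ext
  filter_upwards [coeFn_restr h (extend h hK f), ae_restrict_mem hK,
    ae_mono (Measure.restrict_mono_set volume h) (memLp_indicator h hK f).coeFn_toLp]
    with x h1 h2 h3
  rw [h1, extend, h3, Set.indicator_of_mem h2]

theorem restr_extend_of_disjoint {K K' : Set Plane} (h : K ⊆ Ω) (hK : MeasurableSet K)
    (h' : K' ⊆ Ω) (hK' : MeasurableSet K') (hd : Disjoint K K') (f : L2 K) :
    restr h' (extend h hK f) = 0 := by
  apply Lp.ext
  filter_upwards [coeFn_restr h' (extend h hK f), ae_restrict_mem hK',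
    ae_mono (Measure.restrict_mono_set volume h') (memLp_indicator h hK f).coeFn_toLp,
    Lp.coeFn_zero ℝ 2 (volume.restrict K')] with x h1 h2 h3 h4
  rw [h1, extend, h3, Set.indicator_of_notMem (Set.disjoint_right.1 hd h2), h4]
  rfl

variable (T : QuadMesh Ω)

theorem mem_brokenH1_iff {p : GradPair Ω} :
    p ∈ brokenH1 T ↔ ∀ K : T.elems, restrGrad (T.subset K K.2) p ∈ H1 (K : Set Plane) := by
  simp [brokenH1, Submodule.mem_iInf]

theorem mem_brokenHdiv_iff {q : DivPair Ω} :
    q ∈ brokenHdiv T ↔ ∀ K : T.elems, restrDiv (T.subset K K.2) q ∈ Hdiv (K : Set Plane) := by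
  simp [brokenHdiv, Submodule.mem_iInf]

/-- A function in `H¹(K)` is the restriction of a broken function that vanishes on the other
elements. -/
theorem exists_brokenH1_extension (K : T.elems) {p : GradPair (K : Set Plane)}
    (hp : p ∈ H1 (K : Set Plane)) :
    ∃ p' ∈ brokenH1 T, restrGrad (T.subset K K.2) p' = p ∧
      ∀ K' : T.elems, K' ≠ K → restrGrad (T.subset K' K'.2) p' = 0 := by
  have hm := fun K : T.elems => (T.isOpen K).measurableSet
  have hdisj : ∀ K' : T.elems, K' ≠ K → ∀ f : L2 (K : Set Plane),
      restr (T.subset K' K'.2) (extend (T.subset K K.2) (hm K) f) = 0 := fun K' hne f =>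
    restr_extend_of_disjoint _ _ _ (hm K') (T.pairwise_disjoint hne.symm) f
  let p' : GradPair Ω :=
    (extend (T.subset K K.2) (hm K) p.1, fun i => extend (T.subset K K.2) (hm K) (p.2 i))
  have h1 : restrGrad (T.subset K K.2) p' = p :=
    Prod.ext (restr_extend (T.subset K K.2) (hm K) _)
      (funext fun i => restr_extend (T.subset K K.2) (hm K) _)
  have h2 : ∀ K' : T.elems, K' ≠ K → restrGrad (T.subset K' K'.2) p' = 0 := fun K' hne =>
    Prod.ext (hdisj K' hne _)
      (funext fun i =>
        hdisj K' hne _)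
  refine ⟨p', (mem_brokenH1_iff T).2 fun K' => ?_, h1, h2⟩
  by_cases h : K' = K
  · subst h; rwa [h1]
  · rw [h2 K' h]; exact zero_mem _

/-- A field in `H(div, K)` is the restriction of a broken field that vanishes on the other
elements. -/
theorem exists_brokenHdiv_extension (K : T.elems) {q : DivPair (K : Set Plane)}
    (hq : q ∈ Hdiv (K : Set Plane)) :
    ∃ q' ∈ brokenHdiv T, restrDiv (T.subset K K.2) q' = q ∧
      ∀ K' : T.elems, K' ≠ K → restrDiv (T.subset K' K'.2) q' = 0 := by
  have hm := fun K : T.elems => (T.isOpen K).measurableSet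
  have hdisj : ∀ K' : T.elems, K' ≠ K → ∀ f : L2 (K : Set Plane),
      restr (T.subset K' K'.2) (extend (T.subset K K.2) (hm K) f) = 0 := fun K' hne f =>
    restr_extend_of_disjoint _ _ _ (hm K') (T.pairwise_disjoint hne.symm) f
  let q' : DivPair Ω :=
    (fun i => extend (T.subset K K.2) (hm K) (q.1 i), extend (T.subset K K.2) (hm K) q.2)
  have h1 : restrDiv (T.subset K K.2) q' = q :=
    Prod.ext (funext fun i => restr_extend (T.subset K K.2) (hm K) _)
      (restr_extend (T.subset K K.2) (hm K) _)
  have h2 : ∀ K' : T.elems, K' ≠ K → restrDiv (T.subset K' K'.2) q' = 0 := fun K' hne =>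
    Prod.ext (funext fun i =>
        hdisj K' hne _)
      (hdisj K' hne _)
  refine ⟨q', (mem_brokenHdiv_iff T).2 fun K' => ?_, h1, h2⟩
  by_cases h : K' = K
  · subst h; rwa [h1]
  · rw [h2 K' h]; exact zero_mem _

/-- As `φ` vanishes off `K`, weak identities on `Ω` tested with functions supported in `K` become
the weak identities on `K`. -/
theorem setIntegral_restr_mul {K : Set Plane} (h : K ⊆ Ω) (hΩ : MeasurableSet Ω) (f : L2 Ω)
    {φ : Plane → ℝ} (hφ : IsTestFunction K φ) :
    ∫ x in K, restr h f x * φ x = ∫ x in Ω, f x * φ x := by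
  rw [setIntegral_eq_of_subset_of_forall_sdiff_eq_zero hΩ h
    fun x hx => by rw [hφ.eq_zero_of_notMem hx.2, mul_zero]]
  apply integral_congr_ae
  filter_upwards [coeFn_restr h f] with x hx
  rw [hx]

theorem H1_le_brokenH1 (hΩ : MeasurableSet Ω) : H1 Ω ≤ brokenH1 T := by
  refine fun p hp => (mem_brokenH1_iff T).2 fun K φ hφ i => ?_
  have h := hp φ (hφ.mono (T.subset K K.2)) i
  rw [← setIntegral_restr_mul (T.subset K K.2) hΩ _ (hφ.partialD i),
    ← setIntegral_restr_mul (T.subset K K.2) hΩ _ hφ] at h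
  exact h

theorem Hdiv_le_brokenHdiv (hΩ : MeasurableSet Ω) : Hdiv Ω ≤ brokenHdiv T := by
  refine fun q hq => (mem_brokenHdiv_iff T).2 fun K φ hφ => ?_
  have h := hq φ (hφ.mono (T.subset K K.2))
  rw [Finset.sum_congr rfl fun i _ =>
      (setIntegral_restr_mul (T.subset K K.2) hΩ (q.1 i) (hφ.partialD i)).symm,
    ← setIntegral_restr_mul (T.subset K K.2) hΩ _ hφ] at h
  exact h

/-! ## Skeleton spaces and the boundary pairing -/

/-- On a representative the quotient lift reduces by definition, leaving a sum of element pairings.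
-/
theorem sum_tracePairing (q : brokenHdiv T) (W : H10 Ω) :
    ∑ K : T.elems, tracePairing T K (restrBrokenHdiv T K q) ((traceKer T).mkQ W) =
      bdryPairing Ω W q :=
  sum_bdryPairing T W q

theorem sum_fluxPairing (z : brokenH1 T) (η : Hdiv Ω) :
    ∑ K : T.elems, fluxPairing T K (restrBrokenH1 T K z) ((normalTraceKer T).mkQ η) =
      bdryPairing Ω z η :=
  sum_bdryPairing T z η

/-- Extending a field on `K` by zero collapses the sum to the pairing on `K`; the annihilator
property on `K` then puts the restriction of `W` in `H¹₀(K)`. -/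
theorem mem_traceKer_of_bdryPairing_eq_zero {W : H10 Ω}
    (h : ∀ q ∈ brokenHdiv T, bdryPairing Ω W q = 0) : W ∈ traceKer T := by
  refine (Submodule.mem_iInf _).2 fun K => mem_H10_of_bdryPairing_eq_zero fun q hq => ?_
  obtain ⟨q', hq', h1, h2⟩ := exists_brokenHdiv_extension T K hq
  have h3 := h q' hq'
  rw [← sum_bdryPairing T, Finset.sum_eq_single K (fun K' _ hne => by rw [h2 K' hne, map_zero])
    (by simp), h1] at h3
  exact h3

/-- The same localization; no duality is needed, since a zero normal trace is defined through the
pairing. -/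
theorem mem_normalTraceKer_of_bdryPairing_eq_zero {η : Hdiv Ω}
    (h : ∀ z ∈ brokenH1 T, bdryPairing Ω z η = 0) : η ∈ normalTraceKer T := by
  refine (Submodule.mem_iInf _).2 fun K => (Submodule.mem_iInf _).2 fun z => ?_
  obtain ⟨z', hz', h1, h2⟩ := exists_brokenH1_extension T K z.2
  have h3 := h z' hz'
  rw [← sum_bdryPairing T, Finset.sum_eq_single K
    (fun K' _ hne => by rw [h2 K' hne, map_zero, LinearMap.zero_apply]) (by simp), h1] at h3
  exact h3

/-- A pair whose pairings with `H(div, Ω_h)` are those of an `H¹₀` function belongs to `H¹₀`. -/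
theorem mem_H10_of_bdryPairing_eq (hΩ : MeasurableSet Ω) {p : GradPair Ω} (W : H10 Ω)
    (h : ∀ q ∈ brokenHdiv T, bdryPairing Ω p q = bdryPairing Ω W q) : p ∈ H10 Ω :=
  mem_H10_of_bdryPairing_eq_zero fun q hq =>
    (h q (Hdiv_le_brokenHdiv T hΩ hq)).trans (bdryPairing_eq_zero W.2 hq)

/-- A pair whose pairings with `H¹(Ω_h)` are those of an `H(div)` field belongs to `H(div)`. -/
theorem mem_Hdiv_of_bdryPairing_eq (hΩ : MeasurableSet Ω) {q : DivPair Ω} (η : Hdiv Ω)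
    (h : ∀ z ∈ brokenH1 T, bdryPairing Ω z q = bdryPairing Ω z η) : q ∈ Hdiv Ω :=
  mem_Hdiv_iff.2 fun _ hφ =>
    have hz : hφ.gradPair ∈ H10 Ω := subset_closure hφ.gradPair_mem
    (h _ (H1_le_brokenH1 T hΩ (H10_le_H1 Ω hz))).trans (bdryPairing_eq_zero hz η.2)

/-! ## Uniqueness for the Reissner–Mindlin system -/

theorem sum_inner_compliance_comm (ν : ℝ) (M τ : Fin 2 → Fin 2 → L2 Ω) :
    ∑ i, ∑ j, inner ℝ (M i j) (compliance ν τ i j) =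
      ∑ i, ∑ j, inner ℝ (compliance ν M i j) (τ i j) := by
  simp [compliance, Fin.sum_univ_two, inner_sub_left, inner_sub_right, inner_add_left,
    inner_add_right, real_inner_smul_left, real_inner_smul_right]
  ring

/-- The compliance form of a tensor field, diagonalized. -/
theorem sum_inner_compliance_self {ν : ℝ} (hν : -1 < ν) (M : Fin 2 → Fin 2 → L2 Ω) :
    ∑ i, ∑ j, inner ℝ (compliance ν M i j) (M i j) =
      6 * (‖M 0 1‖ ^ 2 + ‖M 1 0‖ ^ 2 + ((1 - ν) / (2 * (1 + ν))) * ‖M 0 0 + M 1 1‖ ^ 2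
        + (1 / 2) * ‖M 0 0 - M 1 1‖ ^ 2) := by
  have h : 1 + ν ≠ 0 := by linarith
  rw [norm_add_sq_real, norm_sub_sq_real]
  simp [compliance, Fin.sum_univ_two, inner_sub_left, inner_add_left, real_inner_smul_left]
  rw [real_inner_comm (M 0 0) (M 1 1)]
  field_simp
  ring

/-- `J` sees only the skew part: this removes `r` from the energy identity and makes `s` enforce
symmetry of `M`. -/
theorem sum_inner_mulJ (r : L2 Ω) (τ : Fin 2 → Fin 2 → L2 Ω) :
    ∑ i, ∑ j, inner ℝ (mulJ r i j) (τ i j) = inner ℝ r (τ 0 1) - inner ℝ r (τ 1 0) := by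
  simp [mulJ, J, Fin.sum_univ_two, sub_eq_add_neg]

/-- The homogeneous clamped Reissner–Mindlin system has only the zero solution. -/
theorem eq_zero_of_homogeneous_system (hb : Bornology.IsBounded Ω) (hm : MeasurableSet Ω)
    {c ν : ℝ} (hc : 0 < c) (hν : -1 < ν) (hν' : ν < 1)
    {V : Fin 2 → L2 Ω} {M : Fin 2 → Fin 2 → L2 Ω} {w : L2 Ω} {ψ : Fin 2 → L2 Ω} {r : L2 Ω}
    (hw : (w, c • V + ψ) ∈ H10 Ω) (hψ : ∀ i, (ψ i, (compliance ν M + mulJ r) i) ∈ H10 Ω)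
    (hV : (V, 0) ∈ Hdiv Ω) (hM : ∀ i, (M i, -V i) ∈ Hdiv Ω) (hs : M 0 1 = M 1 0) :
    V = 0 ∧ M = 0 ∧ w = 0 ∧ ψ = 0 ∧ r = 0 := by
  -- The term `(ψ, V)` occurs in `h1` and, with the opposite sign, in `h2`; it cancels in their sum,
  -- leaving the energy.
  have h1 := bdryPairing_eq_zero hw hV
  have h2 : ∑ i, bdryPairing Ω (ψ i, (compliance ν M + mulJ r) i) (M i, -V i) = 0 :=
    Finset.sum_eq_zero fun i _ => bdryPairing_eq_zero (hψ i) (hM i)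
  have hC := sum_inner_compliance_self hν M
  have hJ := sum_inner_mulJ r M
  rw [hs, sub_self] at hJ
  simp only [bdryPairing_apply, Pi.add_apply, Pi.smul_apply, inner_add_left, inner_zero_right,
    add_zero, real_inner_smul_left, Finset.sum_add_distrib, inner_neg_right,
    Finset.sum_neg_distrib, hJ, ← Finset.mul_sum, real_inner_self_eq_norm_sq] at h1 h2
  rw [hC] at h2
  -- The weight of the trace part in the compliance energy; its positivity needs both bounds on `ν`.
  have hν1 : 0 < (1 - ν) / (2 * (1 + ν)) := div_pos (by linarith) (by linarith)
  rw [Fin.sum_univ_two] at h1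
  have n0 := mul_nonneg hc.le (sq_nonneg ‖V 0‖)
  have n1 := mul_nonneg hc.le (sq_nonneg ‖V 1‖)
  have n2 := sq_nonneg ‖M 0 1‖
  have n3 := sq_nonneg ‖M 1 0‖
  have n4 := mul_nonneg hν1.le (sq_nonneg ‖M 0 0 + M 1 1‖)
  have n5 := sq_nonneg ‖M 0 0 - M 1 1‖
  have nz : ∀ {a : ℝ} {f : L2 Ω}, 0 < a → a * ‖f‖ ^ 2 = 0 → f = 0 := fun ha hf =>
    norm_eq_zero.1 (pow_eq_zero_iff two_ne_zero |>.1 ((mul_eq_zero.1 hf).resolve_left ha.ne'))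
  have z0 : V 0 = 0 := nz hc (by linarith)
  have z1 : V 1 = 0 := nz hc (by linarith)
  have z2 : M 0 1 = 0 := nz one_pos (by linarith)
  have z3 : M 1 0 = 0 := nz one_pos (by linarith)
  have z4 : M 0 0 + M 1 1 = 0 := nz hν1 (by linarith)
  have z5 : M 0 0 - M 1 1 = 0 := nz one_pos (by linarith)
  have z6 : M 1 1 = 0 := by
    rw [sub_eq_zero.1 z5, ← two_smul ℝ] at z4
    exact (smul_eq_zero.1 z4).resolve_left two_ne_zero
  have z7 : M 0 0 = 0 := by rw [sub_eq_zero.1 z5, z6]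
  have hV0 : V = 0 := by
    funext i; fin_cases i
    exacts [z0, z1]
  have hM0 : M = 0 := by
    funext i j; fin_cases i <;> fin_cases j
    exacts [z7, z2, z3, z6]
  subst hV0 hM0
  have hcomp : compliance ν (0 : Fin 2 → Fin 2 → L2 Ω) = 0 := by
    funext i j; simp [compliance]
  simp only [hcomp, zero_add] at hψ
  simp only [smul_zero, zero_add] at hw
  -- Now `∇ψ₀ = (0, r)` and `∇ψ₁ = (-r, 0)`. The rotated gradient of `ψ₁` is `(0, r)`, so its
  -- pairing with `ψ₀` is `‖r‖²`.
  have hr : r = 0 := by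
    have h := bdryPairing_eq_zero (hψ 0) (rotGrad_mem_Hdiv (H10_le_H1 Ω (hψ 1)))
    rw [bdryPairing_apply, Fin.sum_univ_two] at h
    simpa [mulJ, J] using h
  subst hr
  have hmul : mulJ (0 : L2 Ω) = 0 := by
    funext i j; simp [mulJ]
  have hψ0 : ψ = 0 := by
    funext i
    have h := hψ i
    rw [hmul] at h
    exact eq_zero_of_mem_H10_of_grad_eq_zero hb hm h
  subst hψ0
  exact ⟨rfl, rfl, eq_zero_of_mem_H10_of_grad_eq_zero hb hm hw, rfl, rfl⟩

/-! ## The bilinear form in terms of representatives of the skeleton unknowns -/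

/-- Terms are grouped by test component, with the compliance moved onto `M` by symmetry. Each
bracket compares a pair built from field unknowns with a skeleton representative. -/
theorem B_eq (T : QuadMesh Ω) (κ t ν : ℝ) (V : Fin 2 → L2 Ω) (M : Fin 2 → Fin 2 → L2 Ω) (w : L2 Ω)
    (ψ : Fin 2 → L2 Ω) (r : L2 Ω) (W : H10 Ω) (Ψ : Fin 2 → H10 Ω) (η : Hdiv Ω)
    (μ : Fin 2 → Hdiv Ω) (v : Test T) :
    B T κ t ν ⟨V, M, w, ψ, r, (traceKer T).mkQ W, fun i => (traceKer T).mkQ (Ψ i),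
        (normalTraceKer T).mkQ η, fun i => (normalTraceKer T).mkQ (μ i)⟩ v =
      (bdryPairing Ω (w, (κ⁻¹ * t ^ 2) • V + ψ) v.q - bdryPairing Ω W v.q)
      + (∑ i, (bdryPairing Ω (ψ i, (compliance ν M + mulJ r) i) (v.τ i)
          - bdryPairing Ω (Ψ i) (v.τ i)))
      + (bdryPairing Ω v.z (V, 0) - bdryPairing Ω v.z η)
      + (∑ i, (bdryPairing Ω (v.φ i) (M i, -V i) - bdryPairing Ω (v.φ i) (μ i)))
      + (inner ℝ (M 0 1) v.s - inner ℝ (M 1 0) v.s) := by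
  have hC := sum_inner_compliance_comm ν M v.τField
  have hJ := sum_inner_mulJ v.s M
  simp only [real_inner_comm (M _ _) (mulJ v.s _ _)] at hJ
  rw [real_inner_comm (M 0 1), real_inner_comm (M 1 0)] at hJ
  unfold B
  simp only [Finset.sum_comm (s := (Finset.univ : Finset T.elems)), sum_tracePairing,
    sum_fluxPairing]
  simp only [scpVec, scpTen, scp_eq_inner, Pi.add_apply, Pi.sub_apply, Pi.smul_apply,
    inner_add_right, inner_sub_right, real_inner_smul_right, Finset.sum_add_distrib,
    Finset.sum_sub_distrib, hC]
  simp only [bdryPairing_apply, Pi.add_apply, Pi.smul_apply, inner_add_left, inner_neg_right,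
    inner_zero_right, real_inner_smul_left, real_inner_comm (V _), real_inner_comm (M _ _),
    Finset.sum_add_distrib, Finset.sum_neg_distrib, hJ, ← Finset.mul_sum]
  unfold Test.qField Test.divq Test.τField Test.divτ Test.gradz Test.φField Test.gradφ
  ring

theorem exists_representatives (T : QuadMesh Ω) (u : Trial T) :
    ∃ (W : H10 Ω) (Ψ : Fin 2 → H10 Ω) (η : Hdiv Ω) (μ : Fin 2 → Hdiv Ω),
      u = ⟨u.V, u.M, u.w, u.ψ, u.r, (traceKer T).mkQ W, fun i => (traceKer T).mkQ (Ψ i),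
        (normalTraceKer T).mkQ η, fun i => (normalTraceKer T).mkQ (μ i)⟩ := by
  obtain ⟨W, hW⟩ := Submodule.mkQ_surjective _ u.wHat
  choose Ψ hΨ using fun i => Submodule.mkQ_surjective _ (u.ψHat i)
  obtain ⟨η, hη⟩ := Submodule.mkQ_surjective _ u.VHat
  choose μ hμ using fun i => Submodule.mkQ_surjective _ (u.MHat i)
  refine ⟨W, Ψ, η, μ, ?_⟩
  simp only [hW, hΨ, hη, hμ]

end ReissnerMindlin
end

/-! ### Conclusion: separating the equations and recovering the skeleton unknowns -/

open ReissnerMindlin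

theorem mainTheorem4 (Ω : Set ReissnerMindlin.Plane)
    (hΩ : ReissnerMindlin.IsConvexPolygonalDomain Ω) (T : ReissnerMindlin.QuadMesh Ω)
    (κ t ν : ℝ) (hκ : 0 < κ) (ht : 0 < t) (hν : -1 < ν) (hν' : ν < 1)
    (u : ReissnerMindlin.Trial T)
    (hu : ∀ v : ReissnerMindlin.Test T, ReissnerMindlin.B T κ t ν u v = 0) :
    u.V = 0 ∧ u.M = 0 ∧ u.w = 0 ∧ u.ψ = 0 ∧ u.r = 0 ∧
      u.wHat = 0 ∧ u.ψHat = 0 ∧ u.VHat = 0 ∧ u.MHat = 0 := by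
  have hm := hΩ.isOpen.measurableSet
  obtain ⟨W, Ψ, η, μ, hrep⟩ := exists_representatives T u
  obtain ⟨V, M, w, ψ, r, wHat, ψHat, VHat, MHat⟩ := u
  simp only [Trial.mk.injEq, true_and] at hrep
  obtain ⟨rfl, rfl, rfl, rfl⟩ := hrep
  have hB := fun v => (B_eq T κ t ν V M w ψ r W Ψ η μ v).symm.trans (hu v)
  -- Tests with one nonzero component isolate the equations. They are kept for all broken tests:
  -- conforming ones give the global system, and the rest are needed for the skeleton unknowns.
  have hq : ∀ q ∈ brokenHdiv T,
      bdryPairing Ω (w, (κ⁻¹ * t ^ 2) • V + ψ) q = bdryPairing Ω W q := fun q hq => by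
    have h := hB ⟨⟨q, hq⟩, 0, 0, 0, 0⟩
    simpa [sub_eq_zero] using h
  have hτ : ∀ i, ∀ q ∈ brokenHdiv T,
      bdryPairing Ω (ψ i, (compliance ν M + mulJ r) i) q = bdryPairing Ω (Ψ i) q :=
    fun i q hq => by
      have h := hB ⟨0, Pi.single i ⟨q, hq⟩, 0, 0, 0⟩
      dsimp only at h
      rw [Finset.sum_eq_single i (fun j _ hj => by simp [hj]) (by simp)] at h
      simpa [sub_eq_zero] using h
  have hz : ∀ z ∈ brokenH1 T, bdryPairing Ω z (V, 0) = bdryPairing Ω z η := fun z hz => by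
    have h := hB ⟨0, 0, ⟨z, hz⟩, 0, 0⟩
    simpa [sub_eq_zero] using h
  have hφ : ∀ i, ∀ z ∈ brokenH1 T, bdryPairing Ω z (M i, -V i) = bdryPairing Ω z (μ i) :=
    fun i z hz => by
      have h := hB ⟨0, 0, 0, Pi.single i ⟨z, hz⟩, 0⟩
      dsimp only at h
      rw [Finset.sum_eq_single (f := fun i => _ - bdryPairing Ω _ (μ i).1) i
        (fun j _ hj => by simp [hj]) (by simp)] at h
      simpa [sub_eq_zero] using h
  have hs : M 0 1 = M 1 0 := by
    refine ext_inner_right ℝ fun s => ?_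
    have h := hB ⟨0, 0, 0, 0, s⟩
    simpa [sub_eq_zero] using h
  obtain ⟨rfl, rfl, rfl, rfl, rfl⟩ := eq_zero_of_homogeneous_system hΩ.isBounded hm
    (mul_pos (inv_pos.2 hκ) (pow_pos ht 2)) hν hν'
    (mem_H10_of_bdryPairing_eq T hm W hq)
    (fun i => mem_H10_of_bdryPairing_eq T hm (Ψ i) (hτ i))
    (mem_Hdiv_of_bdryPairing_eq T hm η hz)
    (fun i => mem_Hdiv_of_bdryPairing_eq T hm (μ i) (hφ i)) hs
  -- With the field unknowns zero, the comparison identities say that each representative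
  -- annihilates its whole broken test space.
  refine ⟨rfl, rfl, rfl, rfl, rfl, ?_, funext fun i => ?_, ?_, funext fun i => ?_⟩
  · refine (Submodule.Quotient.mk_eq_zero _).2
      (mem_traceKer_of_bdryPairing_eq_zero T fun q hq' => (hq q hq').symm.trans ?_)
    simp [bdryPairing_apply]
  · refine (Submodule.Quotient.mk_eq_zero _).2
      (mem_traceKer_of_bdryPairing_eq_zero T fun q hq' => (hτ i q hq').symm.trans ?_)
    simp [bdryPairing_apply, compliance, mulJ]
  · refine (Submodule.Quotient.mk_eq_zero _).2
      (mem_normalTraceKer_of_bdryPairing_eq_zero T fun z hz' => (hz z hz').symm.trans ?_)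
    simp [bdryPairing_apply]
  · refine (Submodule.Quotient.mk_eq_zero _).2
      (mem_normalTraceKer_of_bdryPairing_eq_zero T fun z hz' => (hφ i z hz').symm.trans ?_)
    simp [bdryPairing_apply]
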